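/- **Theorem (Global FDR control: quantized model exchange).** *Setting.* Let $K\ge 2$ and let $\mathcal Z$ be a measurable space. The data of each agent $a\in\{1,\dots,K\}$ are split into $K$ blocks; the block $H^{(a\to j)}$ is designated for agent $j$, and $H^{(j\to j)}$ is agent $j$'s own evaluation block. Every block is a finite sequence of $\mathcal Z$-valued random variables, consisting of null training samples, of which the first $k$ form a training set and the other $\ell$ a calibration set, followed by $m$ unlabeled test samples ($k,\ell,m$ may depend on the block). For the evaluation block of agent $j$ write $k_j,\ell_j,m_j$ for the sizes, $Z^{(j)}_1,\dots,Z^{(j)}_{n_j+m_j}$ for the samples with $n_j=k_j+\ell_j$, and let $\mathcal H_0^{(j)}\subseteq\{1,\dots,m_j\}$ be the (deterministic) index set of the true nulls among its test samples. Let $U^{(j)}$ be the sequence of all true nulls $(Z_i^{(j)})_{i\le n_j},(Z^{(j)}_{n_j+t})_{t\in\mathcal H_0^{(j)}}$ and $V^{(j)}=(Z^{(j)}_{n_j+t})_{t\notin \mathcal H_0^{(j)}}$ the sequence of novelties. Let $g^{(j)}(z;h)\in\mathbb R$ (the score function of agent $j$), the deterministic learning algorithm $\mathcal A$ (mapping a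 block to a parameter in $\Theta$; it may differ from block to block), the quantizer $q:\Theta\to\hat\Theta$ and the surrogate score $f(z;\hat\theta)\in\mathbb R$ be measurable, where $\Theta,\hat\Theta$ are measurable spaces ($\hat\Theta$ may be discrete). The quantized composite score of agent $j$ is $$\tilde S^{(j)}(z)=\max\Bigl\{g^{(j)}\bigl(z;H^{(j\to j)}\bigr),\ \max_{a\ne j} f\bigl(z;q(\mathcal A(H^{(a\to j)}))\bigr)\Bigr\},$$ and with $\tilde S^{(j)}_i=\tilde S^{(j)}(Z^{(j)}_i)$ the conformal p-values of agent $j$ are $$p^{(j)}_t=\frac1{\ell_j+1}\Bigl(1+\sum_{i=k_j+1}^{n_j}\mathbf 1\{\tilde S^{(j)}_i\ge \tilde S^{(j)}_{n_j+t}\}\Bigr),\qquad t=1,\dots,m_j .$$ *Assumptions.* (1) The data sets of the $K$ agents are mutually independent. (2) For each agent, its $K$ blocks are mutually independent. (3) For each $j$, $U^{(j)}$ is exchangeable conditionally on $V^{(j)}$, and $g^{(j)}(z;h)$ does not change when the entries of $h$ after the first $k_j$ are permuted. (4) For each $j$, almost surely there are no ties among the scores $\tilde S^{(j)}_i$, $k_j<i\le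 n_j+m_j$. *Definitions.* A set $D\subseteq\mathbb R^I$ is increasing if $x\in D$ and $x\le y$ coordinatewise imply $y\in D$. A random vector $X$ is PRDS on a set $I_0$ of indices if for every increasing set $D$ and every $i\in I_0$, the conditional probability $\mathbb P(X\in D\mid X_i=x)$ has a version that is non-decreasing in $x$. Let $N=\sum_j m_j$ and $0\le\alpha\le1$. The global Benjamini–Hochberg (BH) procedure at level $\alpha$ rejects all hypotheses with p-value at most $\alpha r/N$, where $r\in\{0,\dots,N\}$ is the largest number such that at least $r$ of all $N$ p-values are at most $\alpha r/N$. FastLSU at level $\alpha$ starts with the count $r_0=N$; in round $s$ each agent $j$ reports its number of p-values that are at most $\alpha r_s/N$, and $r_{s+1}$ is the sum of the reported numbers. After $N$ rounds agent $j$ rejects its hypotheses with $p_t^{(j)}\le\alpha r_N/N$. *Conclusion.* (a) For each $j$, the vector of null scores $(\tilde S^{(j)}(U^{(j)}_i))_i$ is exchangeable conditionally on the novelty scores $(\tilde S^{(j)}(V^{(j)}_i))_i$, with respect to all permutations of the null positions that fix the $k_j$ training positions. (b) For each $j$, the vector $(p^{(j)}_t)_{t\le m_j}$ is PRDS on $\mathcal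 H_0^{(j)}$. (c) The concatenation of the p-value vectors of all agents is PRDS on $\mathcal H_0=\bigcup_j\mathcal H_0^{(j)}$ (disjoint union). (d) FastLSU at level $\alpha$ rejects exactly the hypotheses that the global BH procedure at level $\alpha$ rejects, and its global FDR is at most $\alpha$: if $R^{(j)}$ and $F^{(j)}$ are the numbers of rejections and of false rejections (rejected true nulls) of agent $j$, then $$\mathbb E\left[\frac{\sum_{j}F^{(j)}}{\max\{\sum_{j}R^{(j)},1\}}\right]\le\alpha .$$ -/

import Mathlib

open MeasureTheory ProbabilityTheory
open scoped ENNReal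

noncomputable section

/-- The vector `X` is exchangeable, with respect to the index permutations in `G`, conditionally on
`W`: for every `π ∈ G` the conditional laws of `(X_{π i})_i` and of `(X_i)_i` given `W` coincide
almost surely. `G = Set.univ` is conditional exchangeability in the usual sense. -/
def CondExchangeable {Ω ι S T : Type*} [MeasurableSpace Ω] [MeasurableSpace S] [MeasurableSpace T]
    (μ : Measure Ω) (X : Ω → ι → S) (W : Ω → T) (G : Set (Equiv.Perm ι)) : Prop :=
  ∀ π ∈ G, ∀ B : Set (ι → S), MeasurableSet B →
    μ⟦{ω | (fun i => X ω (π i)) ∈ B} | MeasurableSpace.comap W inferInstance⟧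
      =ᵐ[μ] μ⟦{ω | X ω ∈ B} | MeasurableSpace.comap W inferInstance⟧

/-- Positive regression dependence on the subset `I`: for every increasing set `D` and every
`i ∈ I`, the conditional probability `x ↦ P(X ∈ D | X_i = x)` has a non-decreasing version `φ`.
(The event `X ∈ D` has to be measurable; this is automatic for measurable `D`, and for all `D`
when `X` takes finitely many values.) -/
def PRDS {Ω ι : Type*} [MeasurableSpace Ω] (μ : Measure Ω) (X : Ω → ι → ℝ) (I : Set ι) : Prop :=
  ∀ D : Set (ι → ℝ), IsUpperSet D → MeasurableSet {ω | X ω ∈ D} → ∀ i ∈ I,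
    ∃ φ : ℝ → ℝ≥0∞, Monotone φ ∧ ∀ B : Set ℝ, MeasurableSet B →
      μ {ω | X ω ∈ D ∧ X ω i ∈ B} = ∫⁻ x in B, φ x ∂(μ.map (fun ω => X ω i))

/-- Positions in a data block: `k` null training samples used as training set, the remaining `ℓ`
null training samples used as calibration set, and `m` unlabeled test samples. -/
abbrev BlockIdx (k ℓ m : ℕ) : Type := Fin k ⊕ (Fin ℓ ⊕ Fin m)

/-- The sequence of all true nulls of a block (or of their scores): training samples, calibration
samples, and the test samples with index in `H0`. -/
def nullPart {S : Type*} {k ℓ m : ℕ} (H0 : Finset (Fin m)) (h : BlockIdx k ℓ m → S) :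
    Fin k ⊕ (Fin ℓ ⊕ {t : Fin m // t ∈ H0}) → S
  | Sum.inl i => h (Sum.inl i)
  | Sum.inr (Sum.inl i) => h (Sum.inr (Sum.inl i))
  | Sum.inr (Sum.inr t) => h (Sum.inr (Sum.inr t.1))

/-- The sequence of novelties of a block (or of their scores): the test samples with index
outside `H0`. -/
def noveltyPart {S : Type*} {k ℓ m : ℕ} (H0 : Finset (Fin m)) (h : BlockIdx k ℓ m → S) :
    {t : Fin m // t ∉ H0} → S :=
  fun t => h (Sum.inr (Sum.inr t.1))

/-- The permutations of the null positions that fix every training position. -/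
def fixTraining (k ℓ : ℕ) {m : ℕ} (H0 : Finset (Fin m)) :
    Set (Equiv.Perm (Fin k ⊕ (Fin ℓ ⊕ {t : Fin m // t ∈ H0}))) :=
  {π | ∀ i : Fin k, π (Sum.inl i) = Sum.inl i}

section Scores

variable {K : ℕ} {Z Θ Θq : Type*} {k ℓ m : Fin K → Fin K → ℕ}

/-- The quantized composite score of agent `j` at the point `z`: the maximum of agent `j`'s own
score `g j z` trained on its evaluation block `D j j`, and, over all `a ≠ j`, of the surrogate
scores `f z (q (A a j (D a j)))` received from agent `a`, where `D a j` is the block of agent `a`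
that is designated for agent `j`. -/
def compositeScore (g : ∀ j : Fin K, Z → (BlockIdx (k j j) (ℓ j j) (m j j) → Z) → ℝ)
    (f : Z → Θq → ℝ) (q : Θ → Θq)
    (A : ∀ a j : Fin K, (BlockIdx (k a j) (ℓ a j) (m a j) → Z) → Θ)
    (D : ∀ a j : Fin K, BlockIdx (k a j) (ℓ a j) (m a j) → Z) (j : Fin K) (z : Z) : ℝ :=
  Finset.univ.sup' ⟨j, Finset.mem_univ j⟩ fun a =>
    if a = j then g j z (D j j) else f z (q (A a j (D a j)))

/-- The quantized composite scores of all points in agent `j`'s evaluation block. -/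
def blockScores (g : ∀ j : Fin K, Z → (BlockIdx (k j j) (ℓ j j) (m j j) → Z) → ℝ)
    (f : Z → Θq → ℝ) (q : Θ → Θq)
    (A : ∀ a j : Fin K, (BlockIdx (k a j) (ℓ a j) (m a j) → Z) → Θ)
    (D : ∀ a j : Fin K, BlockIdx (k a j) (ℓ a j) (m a j) → Z) (j : Fin K) :
    BlockIdx (k j j) (ℓ j j) (m j j) → ℝ :=
  fun i => compositeScore g f q A D j (D j j i)

end Scores

/-- The empirical (conformal) p-values of the test points of a block with scores `s`. -/
def conformalPValue {k ℓ m : ℕ} (s : BlockIdx k ℓ m → ℝ) (t : Fin m) : ℝ :=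
  1 / ((ℓ : ℝ) + 1) *
    (1 + ∑ i : Fin ℓ, if s (Sum.inr (Sum.inr t)) ≤ s (Sum.inr (Sum.inl i)) then (1 : ℝ) else 0)

/-- The concatenation of the agents' vectors. -/
def concat {K : ℕ} {M : Fin K → ℕ} (p : ∀ j : Fin K, Fin (M j) → ℝ) : (Σ j : Fin K, Fin (M j)) → ℝ :=
  fun i => p i.1 i.2

/-- The rejection set of the Benjamini-Hochberg procedure at level `α`: with `N` hypotheses and
`r` the largest number such that at least `r` p-values are at most `α r / N`, the hypotheses with
p-value at most `α r / N` are rejected. -/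
def bhRejections {ι : Type*} [Fintype ι] (α : ℝ) (p : ι → ℝ) : Finset ι :=
  open Classical in
  let N := Fintype.card ι
  let r := Nat.findGreatest
    (fun r => r ≤ (Finset.univ.filter fun i => p i ≤ α * (r : ℝ) / (N : ℝ)).card) N
  Finset.univ.filter fun i => p i ≤ α * (r : ℝ) / (N : ℝ)

/-- The local rejection set of one agent, given the current global count `r` among `N`
hypotheses. -/
def lsuLocal {M : ℕ} (α : ℝ) (N r : ℕ) (p : Fin M → ℝ) : Finset (Fin M) :=
  open Classical in Finset.univ.filter fun t => p t ≤ α * (r : ℝ) / (N : ℝ)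

/-- The final global rejection count of FastLSU. The count starts at the total number `N` of
hypotheses; in each round every agent sends its local rejection count at the threshold given by
the current global count, and the sum is the new global count. The counts do not increase and
become stationary after at most `N` rounds. -/
def fastLSUCount {K : ℕ} {M : Fin K → ℕ} (α : ℝ) (p : ∀ j : Fin K, Fin (M j) → ℝ) : ℕ :=
  (fun r : ℕ => ∑ j, (lsuLocal α (∑ i, M i) r (p j)).card)^[∑ i, M i] (∑ i, M i)

/-- The rejection set of agent `j` in FastLSU at level `α`. -/
def fastLSURejections {K : ℕ} {M : Fin K → ℕ} (α : ℝ) (p : ∀ j : Fin K, Fin (M j) → ℝ)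
    (j : Fin K) : Finset (Fin (M j)) :=
  lsuLocal α (∑ i, M i) (fastLSUCount α p) (p j)

/-- The global false discovery rate of the random rejection sets `R ω j`, where `H0 j` is the set
of true nulls among agent `j`'s hypotheses. -/
def globalFDR {Ω : Type*} [MeasurableSpace Ω] (μ : Measure Ω) {K : ℕ} {M : Fin K → ℕ}
    (H0 : ∀ j : Fin K, Finset (Fin (M j))) (R : Ω → ∀ j : Fin K, Finset (Fin (M j))) : ℝ :=
  ∫ ω, ((∑ j, (R ω j ∩ H0 j).card : ℕ) : ℝ) / max ((∑ j, (R ω j).card : ℕ) : ℝ) 1 ∂μ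

end

/-! The engine is one symmetry. Fix a true null test position `t` of agent `j` and exchange it with
each of its `ℓ + 1` competitors: itself and the calibration positions. A permutation of the nulls in
the evaluation block that fixes the training positions leaves agent `j`'s score function unchanged,
because `g` ignores order after the training set and the surrogates come from other blocks. So it
merely relabels agent `j`'s scores. It leaves the other agents' scores untouched, because that block
enters no other composite score. Conditional exchangeability makes the law of the block invariant,
and the two independence assumptions lift this to the joint law of all scores
(`identDistrib_update_blockScores`). Projecting to nulls and novelties gives (a).

The rest is deterministic for fixed scores, followed by averaging over the exchanges. With
competitor `e` placed at `t`, the p-value at `t` is the descending rank of `e` divided by `ℓ + 1`,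
and every p-value can only grow as the score of `e` falls (`allPValues_swapScores_mono`). Without
ties exactly one exchange produces each rank. Hence `p_t` is uniform, and the probability of an
increasing event together with a given rank is an average of indicators that grow with the rank.
This is PRDS.

The FDR bound does not pass through PRDS; it uses the same averaging. Among the exchanges after
which `t` is rejected, the one bringing in the lowest score has the fewest rejections, and its rank
bounds the number of such exchanges. The BH threshold then bounds the total share
(`sum_rejectionShare_swapScores_le`). Finally, FastLSU iterates the monotone count map from the top,
so it reaches the greatest fixed point, which is the BH count. -/

section FixedPoint

/-! ### Greatest fixed points of bounded monotone maps on the natural numbers -/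

/-- The greatest `r ≤ N` with `r ≤ G r` is a fixed point of a monotone `G` bounded by `N`. -/
theorem apply_findGreatest_le {G : ℕ → ℕ} (hG : Monotone G) {N : ℕ} (hN : ∀ r, G r ≤ N) :
    G (Nat.findGreatest (fun r => r ≤ G r) N) = Nat.findGreatest (fun r => r ≤ G r) N := by
  have h0 : Nat.findGreatest (fun r => r ≤ G r) N ≤ G (Nat.findGreatest (fun r => r ≤ G r) N) :=
    Nat.findGreatest_spec (P := fun r => r ≤ G r) (Nat.zero_le N) (Nat.zero_le _)
  exact le_antisymm (Nat.le_findGreatest (hN _) (hG h0)) h0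

/-- Iterating a monotone `G` bounded by `N` for `N` rounds from `N` reaches the greatest
fixed point. -/
theorem iterate_eq_findGreatest {G : ℕ → ℕ} (hG : Monotone G) {N : ℕ} (hN : ∀ r, G r ≤ N) :
    G^[N] N = Nat.findGreatest (fun r => r ≤ G r) N := by
  have hfix := apply_findGreatest_le hG hN
  have hmax : ∀ r, r ≤ G r → r ≤ Nat.findGreatest (fun r => r ≤ G r) N :=
    fun r hr => Nat.le_findGreatest (hr.trans (hN r)) hr
  have hle : Nat.findGreatest (fun r => r ≤ G r) N ≤ N := Nat.findGreatest_le N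
  generalize Nat.findGreatest (fun r => r ≤ G r) N = R at *
  -- An iterate above the greatest fixed point `R` violates `r ≤ G r`, so the next round loses at
  -- least one; `N` rounds therefore suffice.
  have key : ∀ s, R ≤ G^[s] N ∧ G^[s] N ≤ max R (N - s) := by
    intro s
    induction s with
    | zero => simp [hle]
    | succ s ih =>
      rw [Function.iterate_succ_apply']
      obtain ⟨h1, h2⟩ := ih
      refine ⟨hfix ▸ hG h1, ?_⟩
      by_cases h : G^[s] N ≤ R
      · exact le_max_of_le_left (hfix ▸ hG h)
      · have := mt (hmax (G^[s] N)) h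
        omega
  have := key N
  simp only [Nat.sub_self] at this
  omega

end FixedPoint

/-! ### The BH procedure as a fixed point, and its agreement with FastLSU -/

section BenjaminiHochberg

/-- The number of p-values at most `α r / N`, as a function of `r`. -/
noncomputable def thresholdCount {ι : Type*} [Fintype ι] (α : ℝ) (p : ι → ℝ) (r : ℕ) : ℕ :=
  open Classical in (Finset.univ.filter fun i => p i ≤ α * (r : ℝ) / (Fintype.card ι : ℝ)).card

variable {ι : Type*} [Fintype ι] {α : ℝ}

theorem thresholdCount_mono (hα : 0 ≤ α) (p : ι → ℝ) : Monotone (thresholdCount α p) := by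
  classical
  intro r s hrs
  unfold thresholdCount
  refine Finset.card_le_card fun i hi => ?_
  simp only [Finset.mem_filter, Finset.mem_univ, true_and] at hi ⊢
  refine hi.trans ?_
  gcongr

theorem thresholdCount_le_card (p : ι → ℝ) (r : ℕ) : thresholdCount α p r ≤ Fintype.card ι :=
  Finset.card_le_univ _

theorem thresholdCount_anti {p p' : ι → ℝ} (h : p ≤ p') (r : ℕ) :
    thresholdCount α p' r ≤ thresholdCount α p r := by
  classical
  unfold thresholdCount
  refine Finset.card_le_card fun i hi => ?_
  simp only [Finset.mem_filter, Finset.mem_univ, true_and] at hi ⊢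
  exact (h i).trans hi

theorem card_bhRejections_eq_findGreatest (hα : 0 ≤ α) (p : ι → ℝ) :
    (bhRejections α p).card =
      Nat.findGreatest (fun r => r ≤ thresholdCount α p r) (Fintype.card ι) :=
  apply_findGreatest_le (thresholdCount_mono hα p) (thresholdCount_le_card p)

/-- Self-consistency of BH: the number `r` that sets the threshold is a fixed point of the count
map, hence is itself the number of rejections. -/
theorem mem_bhRejections (hα : 0 ≤ α) (p : ι → ℝ) (i : ι) :
    i ∈ bhRejections α p ↔ p i ≤ α * ((bhRejections α p).card : ℝ) / (Fintype.card ι : ℝ) := by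
  classical
  conv_rhs => rw [card_bhRejections_eq_findGreatest hα p]
  simp only [bhRejections, Finset.mem_filter, Finset.mem_univ, true_and]
  rfl

/-- Smaller p-values increase every threshold count, so more candidates `r` are feasible. -/
theorem card_bhRejections_anti (hα : 0 ≤ α) {p p' : ι → ℝ} (h : p ≤ p') :
    (bhRejections α p').card ≤ (bhRejections α p).card := by
  rw [card_bhRejections_eq_findGreatest hα, card_bhRejections_eq_findGreatest hα]
  exact Nat.findGreatest_mono_left (fun r hr => hr.trans (thresholdCount_anti h r)) _

theorem sum_card_lsuLocal {K : ℕ} {M : Fin K → ℕ} (p : ∀ j : Fin K, Fin (M j) → ℝ) (r : ℕ) :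
    ∑ j, (lsuLocal α (∑ i, M i) r (p j)).card = thresholdCount α (concat p) r := by
  classical
  simp only [lsuLocal, thresholdCount, Finset.card_filter, Fintype.sum_sigma, concat,
    Fintype.card_sigma, Fintype.card_fin]

theorem fastLSUCount_eq {K : ℕ} {M : Fin K → ℕ} (hα : 0 ≤ α) (p : ∀ j : Fin K, Fin (M j) → ℝ) :
    fastLSUCount α p = (bhRejections α (concat p)).card := by
  rw [card_bhRejections_eq_findGreatest hα, fastLSUCount]
  simp only [sum_card_lsuLocal]
  have hN : ∑ i, M i = Fintype.card (Σ j, Fin (M j)) := by simp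
  rw [hN]
  exact iterate_eq_findGreatest (thresholdCount_mono hα _) (thresholdCount_le_card _)

/-- FastLSU rejects exactly the hypotheses rejected by the global BH procedure. -/
theorem mem_fastLSURejections_iff {K : ℕ} {M : Fin K → ℕ} (hα : 0 ≤ α)
    (p : ∀ j : Fin K, Fin (M j) → ℝ) (j : Fin K) (t : Fin (M j)) :
    t ∈ fastLSURejections α p j ↔ (⟨j, t⟩ : Σ j, Fin (M j)) ∈ bhRejections α (concat p) := by
  rw [mem_bhRejections hα, fastLSURejections, fastLSUCount_eq hα]
  simp [lsuLocal, concat]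

end BenjaminiHochberg

/-! ### Descending ranks -/

section Ranks

variable {E : Type*} [Fintype E]

/-- The rank of `e` when the values of `v` are sorted in decreasing order. -/
noncomputable def descRank (v : E → ℝ) (e : E) : ℕ :=
  open Classical in (Finset.univ.filter fun x => v e ≤ v x).card

theorem descRank_anti {v : E → ℝ} {e e' : E} (h : v e' ≤ v e) : descRank v e ≤ descRank v e' := by
  classical
  unfold descRank
  refine Finset.card_le_card fun i hi => ?_
  simp only [Finset.mem_filter, Finset.mem_univ, true_and] at hi ⊢
  exact h.trans hi

theorem descRank_strictAnti {v : E → ℝ} {e e' : E} (h : v e' < v e) :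
    descRank v e < descRank v e' := by
  classical
  unfold descRank
  refine Finset.card_lt_card (Finset.ssubset_iff_of_subset (fun i hi => ?_) |>.2 ⟨e', ?_, ?_⟩)
  · simp only [Finset.mem_filter, Finset.mem_univ, true_and] at hi ⊢
    exact h.le.trans hi
  · simp
  · simpa using h

theorem descRank_le_iff {v : E → ℝ} {e e' : E} : descRank v e ≤ descRank v e' ↔ v e' ≤ v e :=
  ⟨fun h => le_of_not_gt fun h' => absurd (descRank_strictAnti h') h.not_gt, descRank_anti⟩

theorem descRank_injective {v : E → ℝ} (hv : Function.Injective v) :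
    Function.Injective (descRank v) := fun _ _ h =>
  hv (le_antisymm (descRank_le_iff.1 h.ge) (descRank_le_iff.1 h.le))

theorem descRank_pos (v : E → ℝ) (e : E) : 0 < descRank v e := by
  classical
  exact Finset.card_pos.2 ⟨e, by simp⟩

theorem descRank_le_card (v : E → ℝ) (e : E) : descRank v e ≤ Fintype.card E :=
  Finset.card_le_univ _

/-- Without ties every rank is taken. -/
theorem exists_descRank_eq {v : E → ℝ} (hv : Function.Injective v) {n : ℕ}
    (hn : Fintype.card E = n) (r : Fin n) : ∃ e, descRank v e = r + 1 := by
  -- Ranks start at 1, because each element counts itself; they are shifted by one to land in `Fin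
  -- n`.
  have hlt : ∀ e, descRank v e - 1 < n := fun e => by
    have := descRank_pos v e
    have := descRank_le_card v e
    omega
  have hinj : Function.Injective fun e => (⟨descRank v e - 1, hlt e⟩ : Fin n) := by
    intro e e' h
    have h1 := descRank_pos v e
    have h2 := descRank_pos v e'
    simp only [Fin.mk.injEq] at h
    exact descRank_injective hv (by omega)
  obtain ⟨e, he⟩ :=
    ((Fintype.bijective_iff_injective_and_card _).2 ⟨hinj, by simpa using hn⟩).2 r
  refine ⟨e, ?_⟩
  have := descRank_pos v e
  have := congrArg Fin.val he
  simp only at this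
  omega

end Ranks

/-! ### Effect on the p-values of exchanging a test point with a competitor -/

section Swaps

variable {k ℓ m : ℕ}

/-- The positions competing with the test position `t`: `t` itself and all calibration positions. -/
def competitor (k : ℕ) {ℓ m : ℕ} (t : Fin m) : Option (Fin ℓ) → BlockIdx k ℓ m
  | none => Sum.inr (Sum.inr t)
  | some c => Sum.inr (Sum.inl c)

theorem competitor_injective (t : Fin m) :
    Function.Injective (competitor k t : Option (Fin ℓ) → _) := by
  rintro (_ | c) (_ | c') h <;> simp_all [competitor]

/-- Exchange of the test position `t` with one of its competitors. -/
def competitorSwap (k : ℕ) {ℓ m : ℕ} (t : Fin m) (e : Option (Fin ℓ)) :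
    Equiv.Perm (BlockIdx k ℓ m) :=
  Equiv.swap (Sum.inr (Sum.inr t)) (competitor k t e)

theorem competitorSwap_competitor (t : Fin m) (e x : Option (Fin ℓ)) :
    competitorSwap k t e (competitor k t x) = competitor k t (Equiv.swap none e x) := by
  rw [(competitor_injective t).map_swap]
  rfl

theorem competitorSwap_self (t : Fin m) (e : Option (Fin ℓ)) :
    competitorSwap k t e (Sum.inr (Sum.inr t)) = competitor k t e :=
  Equiv.swap_apply_left _ _

theorem competitorSwap_of_ne {t u : Fin m} (h : u ≠ t) (e : Option (Fin ℓ)) :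
    competitorSwap k t e (Sum.inr (Sum.inr u)) = Sum.inr (Sum.inr u) := by
  refine Equiv.swap_apply_of_ne_of_ne (by simpa using h) ?_
  cases e <;> simp [competitor, h]

/-- After the exchange the calibration positions hold all competitors except `e`. Counting over all
competitors and removing `e` isolates the dependence on `e`: for `u ≠ t` it sits in the subtracted
indicator alone. -/
theorem conformalPValue_comp_competitorSwap (s : BlockIdx k ℓ m → ℝ) (t u : Fin m)
    (e : Option (Fin ℓ)) :
    conformalPValue (s ∘ competitorSwap k t e) u = 1 / ((ℓ : ℝ) + 1) *
      (1 - (if s (competitorSwap k t e (Sum.inr (Sum.inr u))) ≤ s (competitor k t e)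
          then (1 : ℝ) else 0) +
        ∑ x, if s (competitorSwap k t e (Sum.inr (Sum.inr u))) ≤ s (competitor k t x)
          then (1 : ℝ) else 0) := by
  set y := s (competitorSwap k t e (Sum.inr (Sum.inr u))) with hy
  have h := Equiv.sum_comp (Equiv.swap none e)
    (fun x => if y ≤ s (competitor k t x) then (1 : ℝ) else 0)
  rw [Fintype.sum_option, Equiv.swap_apply_left] at h
  have h' : ∀ a b : ℝ, 1 - a + (a + b) = 1 + b := fun a b => by ring
  rw [← h, h', conformalPValue]
  simp only [Function.comp_apply, ← hy]
  refine congrArg _ (congrArg _ (Finset.sum_congr rfl fun c _ => ?_))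
  rw [← competitorSwap_competitor]
  rfl

/-- At `t` itself the compared score is that of `e`, so the removed indicator cancels the leading 1
and the bare rank remains. -/
theorem conformalPValue_comp_competitorSwap_self (s : BlockIdx k ℓ m → ℝ) (t : Fin m)
    (e : Option (Fin ℓ)) :
    conformalPValue (s ∘ competitorSwap k t e) t =
      1 / ((ℓ : ℝ) + 1) * descRank (fun x => s (competitor k t x)) e := by
  classical
  rw [conformalPValue_comp_competitorSwap, competitorSwap_self]
  rw [if_pos le_rfl, sub_self, zero_add, Finset.sum_boole, descRank]

/-- The p-values increase when `t` is exchanged with a competitor of lower score. -/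
theorem conformalPValue_comp_competitorSwap_mono (s : BlockIdx k ℓ m → ℝ) (t u : Fin m)
    {e e' : Option (Fin ℓ)} (h : s (competitor k t e') ≤ s (competitor k t e)) :
    conformalPValue (s ∘ competitorSwap k t e) u ≤
      conformalPValue (s ∘ competitorSwap k t e') u := by
  by_cases hu : u = t
  · subst hu
    rw [conformalPValue_comp_competitorSwap_self, conformalPValue_comp_competitorSwap_self]
    have := descRank_anti (v := fun x => s (competitor k u x)) h
    gcongr
  · rw [conformalPValue_comp_competitorSwap, conformalPValue_comp_competitorSwap,
      competitorSwap_of_ne hu, competitorSwap_of_ne hu]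
    gcongr ?_ * (1 - ?_ + _)
    split_ifs with h1 h2 <;> first | exact le_rfl | exact zero_le_one | exact absurd (h1.trans h) h2

end Swaps

/-! ### Permutations of the null positions -/

section NullPositions

variable {k ℓ m : ℕ} (H0 : Finset (Fin m))

/-- A block consists of its null positions and its novelty positions. -/
def nullNoveltyEquiv (k ℓ : ℕ) {m : ℕ} (H0 : Finset (Fin m)) :
    (Fin k ⊕ (Fin ℓ ⊕ {t : Fin m // t ∈ H0})) ⊕ {t : Fin m // t ∉ H0} ≃ BlockIdx k ℓ m :=
  (Equiv.sumAssoc _ _ _).trans (Equiv.sumCongr (Equiv.refl _)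
    ((Equiv.sumAssoc _ _ _).trans (Equiv.sumCongr (Equiv.refl _) (Equiv.sumCompl (· ∈ H0)))))

theorem nullPart_eq {S : Type*} (h : BlockIdx k ℓ m → S) :
    nullPart H0 h = fun i => h (nullNoveltyEquiv k ℓ H0 (Sum.inl i)) := by
  funext i
  rcases i with i | i | i <;> rfl

theorem noveltyPart_eq {S : Type*} (h : BlockIdx k ℓ m → S) :
    noveltyPart H0 h = fun i => h (nullNoveltyEquiv k ℓ H0 (Sum.inr i)) := rfl

/-- The permutation of a block that permutes the null positions by `π` and fixes the novelties. -/
def extendNullPerm (π : Equiv.Perm (Fin k ⊕ (Fin ℓ ⊕ {t : Fin m // t ∈ H0}))) :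
    Equiv.Perm (BlockIdx k ℓ m) :=
  (nullNoveltyEquiv k ℓ H0).permCongr (Equiv.sumCongr π (Equiv.refl _))

theorem nullPart_comp_extendNullPerm {S : Type*} (h : BlockIdx k ℓ m → S)
    (π : Equiv.Perm (Fin k ⊕ (Fin ℓ ⊕ {t : Fin m // t ∈ H0}))) :
    nullPart H0 (h ∘ extendNullPerm H0 π) = fun i => nullPart H0 h (π i) := by
  simp [nullPart_eq, extendNullPerm, Equiv.permCongr_apply]

theorem noveltyPart_comp_extendNullPerm {S : Type*} (h : BlockIdx k ℓ m → S)
    (π : Equiv.Perm (Fin k ⊕ (Fin ℓ ⊕ {t : Fin m // t ∈ H0}))) :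
    noveltyPart H0 (h ∘ extendNullPerm H0 π) = noveltyPart H0 h := by
  simp [noveltyPart_eq, extendNullPerm, Equiv.permCongr_apply]

/-- Exchanges of a null test position with a competitor permute the null positions and fix the
training positions. -/
theorem exists_competitorSwap_eq_extendNullPerm {t : Fin m} (ht : t ∈ H0) (e : Option (Fin ℓ)) :
    ∃ π ∈ fixTraining k ℓ H0, extendNullPerm H0 π = competitorSwap k t e := by
  have key : ∀ a b : Fin ℓ ⊕ {t : Fin m // t ∈ H0},
      extendNullPerm H0 (Equiv.swap (Sum.inr a) (Sum.inr b) : Equiv.Perm (Fin k ⊕ _)) =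
        Equiv.swap (nullNoveltyEquiv k ℓ H0 (Sum.inl (Sum.inr a)))
          (nullNoveltyEquiv k ℓ H0 (Sum.inl (Sum.inr b))) := by
    intro a b
    have := Equiv.Perm.sumCongr_swap_refl (β := {t : Fin m // t ∉ H0})
      (Sum.inr a : Fin k ⊕ (Fin ℓ ⊕ {t : Fin m // t ∈ H0})) (Sum.inr b)
    refine (congrArg (nullNoveltyEquiv k ℓ H0).permCongr this).trans ?_
    rw [Equiv.permCongr_def, Equiv.symm_trans_swap_trans]
  rcases e with _ | c
  · refine ⟨Equiv.swap (Sum.inr (Sum.inr ⟨t, ht⟩)) (Sum.inr (Sum.inr ⟨t, ht⟩)), ?_, ?_⟩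
    · intro i
      simp
    · rw [key]; rfl
  · refine ⟨Equiv.swap (Sum.inr (Sum.inr ⟨t, ht⟩)) (Sum.inr (Sum.inl c)), ?_, ?_⟩
    · intro i
      exact Equiv.swap_apply_of_ne_of_ne (by simp) (by simp)
    · rw [key]; rfl

/-- Brings such a permutation into the form in which the order invariance of `g` is assumed. -/
theorem exists_extendNullPerm_eq_sumMap
    {π : Equiv.Perm (Fin k ⊕ (Fin ℓ ⊕ {t : Fin m // t ∈ H0}))} (hπ : π ∈ fixTraining k ℓ H0) :
    ∃ σ : Equiv.Perm (Fin ℓ ⊕ Fin m), ⇑(extendNullPerm H0 π) = Sum.map id σ := by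
  have hfix : ∀ i : Fin k, extendNullPerm H0 π (Sum.inl i) = Sum.inl i := by
    intro i
    have : (Sum.inl i : BlockIdx k ℓ m) = nullNoveltyEquiv k ℓ H0 (Sum.inl (Sum.inl i)) := rfl
    rw [this, extendNullPerm, Equiv.permCongr_apply, Equiv.symm_apply_apply]
    simp [hπ i]
  obtain ⟨⟨σ₁, σ₂⟩, h⟩ := Equiv.Perm.mem_sumCongrHom_range_of_perm_mapsTo_inl
    (σ := extendNullPerm H0 π) (by rintro _ ⟨i, rfl⟩; exact ⟨i, (hfix i).symm⟩)
  refine ⟨σ₂, funext fun i => ?_⟩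
  rcases i with i | i
  · exact hfix i
  · rw [← h]; rfl

end NullPositions

/-! ### Exchanges acting on the scores of all agents -/

section ScoreSwaps

variable {K : ℕ} {k ℓ m : Fin K → ℕ}

/-- All p-values as a function of all scores. -/
noncomputable def allPValues (s : ∀ j, BlockIdx (k j) (ℓ j) (m j) → ℝ) : (Σ j, Fin (m j)) → ℝ :=
  concat fun j t => conformalPValue (s j) t

/-- The scores after exchange of the test position `t` of agent `j` with one of its competitors. -/
def swapScores (s : ∀ j, BlockIdx (k j) (ℓ j) (m j) → ℝ) (j : Fin K) (t : Fin (m j))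
    (e : Option (Fin (ℓ j))) : ∀ j, BlockIdx (k j) (ℓ j) (m j) → ℝ :=
  Function.update s j (s j ∘ competitorSwap (k j) t e)

theorem measurable_swapScores (j : Fin K) (t : Fin (m j)) (e : Option (Fin (ℓ j))) :
    Measurable fun s : ∀ j, BlockIdx (k j) (ℓ j) (m j) → ℝ => swapScores s j t e := by
  refine measurable_pi_iff.2 fun j' => ?_
  by_cases h : j' = j
  · subst h
    simp only [swapScores, Function.update_self]
    refine measurable_pi_iff.2 fun i => ?_
    simp only [Function.comp_apply]
    fun_prop
  · simp only [swapScores, Function.update_of_ne h]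
    fun_prop

/-- The p-values take finitely many values, so that every event about them is measurable. -/
theorem measurableSet_allPValues_mem (Q : Set ((Σ j, Fin (m j)) → ℝ)) :
    MeasurableSet {s : ∀ j, BlockIdx (k j) (ℓ j) (m j) → ℝ | allPValues s ∈ Q} := by
  -- The p-values factor through these integer counts, which live in a discrete space where every
  -- set is measurable.
  let c : (∀ j, BlockIdx (k j) (ℓ j) (m j) → ℝ) → (Σ j, Fin (m j)) → ℕ := fun s i =>
    ∑ x : Fin (ℓ i.1), if s i.1 (Sum.inr (Sum.inr i.2)) ≤ s i.1 (Sum.inr (Sum.inl x)) then 1 else 0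
  have hc : Measurable c := by
    refine measurable_pi_iff.2 fun i => Finset.measurable_sum _ fun x _ => ?_
    exact Measurable.ite (measurableSet_le (by fun_prop) (by fun_prop)) measurable_const
      measurable_const
  have h : {s : ∀ j, BlockIdx (k j) (ℓ j) (m j) → ℝ | allPValues s ∈ Q} =
      c ⁻¹' {n | (fun i => 1 / ((ℓ i.1 : ℝ) + 1) * (1 + (n i : ℝ))) ∈ Q} := by
    ext s
    have : allPValues s = fun i => 1 / ((ℓ i.1 : ℝ) + 1) * (1 + (c s i : ℝ)) := by
      funext i
      simp [allPValues, concat, conformalPValue, c]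
    simp [this]
  rw [h]
  exact hc (MeasurableSet.of_discrete)

theorem allPValues_swapScores_self (s : ∀ j, BlockIdx (k j) (ℓ j) (m j) → ℝ) (j : Fin K)
    (t : Fin (m j)) (e : Option (Fin (ℓ j))) :
    allPValues (swapScores s j t e) ⟨j, t⟩ =
      1 / ((ℓ j : ℝ) + 1) * descRank (fun x => s j (competitor (k j) t x)) e := by
  simp only [allPValues, concat, swapScores, Function.update_self]
  exact conformalPValue_comp_competitorSwap_self _ _ _

theorem allPValues_swapScores_mono (s : ∀ j, BlockIdx (k j) (ℓ j) (m j) → ℝ) (j : Fin K)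
    (t : Fin (m j)) {e e' : Option (Fin (ℓ j))}
    (h : s j (competitor (k j) t e') ≤ s j (competitor (k j) t e)) :
    allPValues (swapScores s j t e) ≤ allPValues (swapScores s j t e') := by
  rintro ⟨j', u⟩
  by_cases hj : j' = j
  · subst hj
    simp only [allPValues, concat, swapScores, Function.update_self]
    exact conformalPValue_comp_competitorSwap_mono _ _ _ h
  · simp [allPValues, concat, swapScores, Function.update_of_ne hj]

theorem swapScores_none (s : ∀ j, BlockIdx (k j) (ℓ j) (m j) → ℝ) (j : Fin K) (t : Fin (m j)) :
    swapScores s j t none = s := by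
  simp [swapScores, competitorSwap, competitor]

theorem exists_allPValues_eq (s : ∀ j, BlockIdx (k j) (ℓ j) (m j) → ℝ) (j : Fin K)
    (t : Fin (m j)) :
    ∃ r : Fin (ℓ j + 1), allPValues s ⟨j, t⟩ = 1 / ((ℓ j : ℝ) + 1) * ((r : ℕ) + 1) := by
  have h := allPValues_swapScores_self s j t none
  rw [swapScores_none] at h
  have h1 := descRank_pos (fun x => s j (competitor (k j) t x)) none
  have h2 := descRank_le_card (fun x => s j (competitor (k j) t x)) none
  rw [Fintype.card_option, Fintype.card_fin] at h2
  refine ⟨⟨descRank (fun x => s j (competitor (k j) t x)) none - 1, by omega⟩, ?_⟩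
  rw [h, Nat.cast_sub h1]
  simp

/-- Without ties exactly one exchange yields a given p-value at the exchanged position. -/
theorem sum_indicator_swapScores {s : ∀ j, BlockIdx (k j) (ℓ j) (m j) → ℝ} {j : Fin K}
    {t : Fin (m j)} (hs : Function.Injective fun i => s j (Sum.inr i))
    (Q : Set ((Σ j, Fin (m j)) → ℝ)) (r : Fin (ℓ j + 1)) :
    ∃ e, descRank (fun x => s j (competitor (k j) t x)) e = r + 1 ∧
      ∑ e', {p | p ∈ Q ∧ p ⟨j, t⟩ = 1 / ((ℓ j : ℝ) + 1) * ((r : ℕ) + 1)}.indicator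
          (1 : ((Σ j, Fin (m j)) → ℝ) → ℝ≥0∞) (allPValues (swapScores s j t e')) =
        Q.indicator 1 (allPValues (swapScores s j t e)) := by
  have hv : Function.Injective fun x => s j (competitor (k j) t x) := by
    rintro (_ | x) (_ | y) h
    · rfl
    · exact absurd (hs (a₁ := Sum.inr t) (a₂ := Sum.inl y) h) (by simp)
    · exact absurd (hs (a₁ := Sum.inl x) (a₂ := Sum.inr t) h) (by simp)
    · simpa using hs (a₁ := Sum.inl x) (a₂ := Sum.inl y) h
  have hpos : (0 : ℝ) < 1 / ((ℓ j : ℝ) + 1) := by positivity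
  obtain ⟨e, he⟩ := exists_descRank_eq hv (n := ℓ j + 1) (by simp) r
  refine ⟨e, he, ?_⟩
  rw [Finset.sum_eq_single e]
  · classical
    simp only [Set.indicator_apply, Set.mem_ofPred_eq, allPValues_swapScores_self, he]
    simp
  · intro e' _ hne
    refine Set.indicator_of_notMem (fun h => hne ?_) _
    have h2 := h.2
    rw [allPValues_swapScores_self] at h2
    have h3 := mul_left_cancel₀ hpos.ne' h2
    exact descRank_injective hv (by rw [he]; exact_mod_cast h3)
  · simp

end ScoreSwaps

/-! ### Monotone conditional probabilities given a discrete variable -/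

section DiscretePRDS

variable {Ω : Type*} [MeasurableSpace Ω] {μ : Measure Ω} {n : ℕ}

/-- If `Y` is uniformly distributed on `v 0 < v 1 < ⋯` and `P(E, Y = v r)` increases with `r`, then
`P(E | Y = y)` has a monotone version. -/
theorem exists_monotone_condProb_version {Y : Ω → ℝ} (hY : Measurable Y) {v : Fin n → ℝ}
    (hv : StrictMono v) (hYv : ∀ ω, ∃ r, Y ω = v r) {c : ℝ≥0∞} (hc0 : c ≠ 0) (hc : c ≠ ∞)
    (hunif : ∀ r, μ {ω | Y ω = v r} = c) {E : Set Ω} (hE : MeasurableSet E)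
    (hmono : Monotone fun r => μ {ω | ω ∈ E ∧ Y ω = v r}) :
    ∃ φ : ℝ → ℝ≥0∞, Monotone φ ∧ ∀ B : Set ℝ, MeasurableSet B →
      μ {ω | ω ∈ E ∧ Y ω ∈ B} = ∫⁻ x in B, φ x ∂(μ.map Y) := by
  -- The running supremum over the atoms up to `x` is monotone by construction. By `hmono` it equals
  -- the conditional probability at each atom; below the first atom it is the empty supremum 0.
  let φ : ℝ → ℝ≥0∞ := fun x => ⨆ r, ⨆ (_ : v r ≤ x), c⁻¹ * μ {ω | ω ∈ E ∧ Y ω = v r}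
  have hφ : Monotone φ := fun x y hxy =>
    iSup_mono fun r => iSup_le fun h => le_iSup_of_le (h.trans hxy) le_rfl
  have hφv : ∀ r, φ (v r) = c⁻¹ * μ {ω | ω ∈ E ∧ Y ω = v r} := by
    intro r
    refine le_antisymm (iSup_le fun r' => iSup_le fun h => ?_)
      (le_iSup_of_le r (le_iSup_of_le le_rfl le_rfl))
    exact mul_le_mul_right (hmono (hv.le_iff_le.1 h)) _
  have hset : ∀ r, MeasurableSet {ω | Y ω = v r} := fun r => hY (measurableSet_singleton _)
  have hdisj : ∀ T : Set Ω, Pairwise (Function.onFun Disjoint fun r => T ∩ {ω | Y ω = v r}) := by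
    intro T r r' hr
    refine Set.disjoint_left.2 fun ω h h' => hr (hv.injective ?_)
    rw [← h.2, ← h'.2]
  have hunion : ∀ T : Set Ω, T = ⋃ r, T ∩ {ω | Y ω = v r} := by
    intro T
    ext ω
    simp [hYv ω]
  -- Both sides are split over the atoms of `Y` and compared termwise, according to whether the atom
  -- lies in `B`.
  refine ⟨φ, hφ, fun B hB => ?_⟩
  have hEB : MeasurableSet {ω | ω ∈ E ∧ Y ω ∈ B} := hE.inter (hY hB)
  rw [setLIntegral_map hB hφ.measurable hY, hunion (Y ⁻¹' B),
    lintegral_iUnion (fun r => (hY hB).inter (hset r)) (hdisj _),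
    hunion {ω | ω ∈ E ∧ Y ω ∈ B}, measure_iUnion (hdisj _) (fun r => hEB.inter (hset r))]
  refine tsum_congr fun r => ?_
  rw [setLIntegral_congr_fun (g := fun _ => φ (v r)) ((hY hB).inter (hset r))
    (fun ω hω => congrArg φ hω.2),
    setLIntegral_const, hφv]
  by_cases hr : v r ∈ B
  · have h1 : {ω | ω ∈ E ∧ Y ω ∈ B} ∩ {ω | Y ω = v r} = {ω | ω ∈ E ∧ Y ω = v r} := by
      ext ω
      simp only [Set.mem_inter_iff, Set.mem_ofPred_eq]
      exact ⟨fun h => ⟨h.1.1, h.2⟩, fun h => ⟨⟨h.1, h.2 ▸ hr⟩, h.2⟩⟩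
    have h2 : Y ⁻¹' B ∩ {ω | Y ω = v r} = {ω | Y ω = v r} := by
      ext ω
      simp only [Set.mem_inter_iff, Set.mem_preimage, Set.mem_ofPred_eq]
      exact ⟨fun h => h.2, fun h => ⟨h ▸ hr, h⟩⟩
    rw [h1, h2, hunif, mul_right_comm, ENNReal.inv_mul_cancel hc0 hc, one_mul]
  · have h1 : {ω | ω ∈ E ∧ Y ω ∈ B} ∩ {ω | Y ω = v r} = ∅ := by
      ext ω
      simp only [Set.mem_inter_iff, Set.mem_ofPred_eq, Set.mem_empty_iff_false, iff_false]
      exact fun h => hr (h.2 ▸ h.1.2)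
    have h2 : Y ⁻¹' B ∩ {ω | Y ω = v r} = ∅ := by
      ext ω
      simp only [Set.mem_inter_iff, Set.mem_preimage, Set.mem_ofPred_eq, Set.mem_empty_iff_false,
        iff_false]
      exact fun h => hr (h.2 ▸ h.1)
    rw [h1, h2, measure_empty, mul_zero]

/-- PRDS passes to subvectors. -/
theorem PRDS.comp {ι κ : Type*} {X : Ω → ι → ℝ} {I : Set ι} (h : PRDS μ X I) (f : κ → ι) :
    PRDS μ (fun ω i => X ω (f i)) (f ⁻¹' I) := by
  intro Q hQ hm i hi
  exact h {x | (fun i => x (f i)) ∈ Q} (fun x y hxy hx => hQ (fun i => hxy (f i)) hx) hm (f i) hi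

end DiscretePRDS

/-! ### PRDS from invariance under exchanges -/

section SwapInvariance

variable {Ω : Type*} [MeasurableSpace Ω] {μ : Measure Ω}
  {K : ℕ} {k ℓ m : Fin K → ℕ} {S : Ω → ∀ j, BlockIdx (k j) (ℓ j) (m j) → ℝ}

/-- Averaging over the exchanges of a null test position with its competitors. -/
theorem lintegral_eq_lintegral_sum_swapScores {j : Fin K} {t : Fin (m j)} (hS : Measurable S)
    (hinv : ∀ e, IdentDistrib (fun ω => swapScores (S ω) j t e) S μ μ)
    {F : (∀ j, BlockIdx (k j) (ℓ j) (m j) → ℝ) → ℝ≥0∞} (hF : Measurable F) :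
    ((ℓ j : ℝ≥0∞) + 1) * ∫⁻ ω, F (S ω) ∂μ = ∫⁻ ω, ∑ e, F (swapScores (S ω) j t e) ∂μ := by
  have hm : ∀ e, Measurable fun ω => F (swapScores (S ω) j t e) :=
    fun e => hF.comp ((measurable_swapScores j t e).comp hS)
  rw [lintegral_finsetSum _ fun e _ => hm e]
  have h : ∀ e, ∫⁻ ω, F (swapScores (S ω) j t e) ∂μ = ∫⁻ ω, F (S ω) ∂μ :=
    fun e => ((hinv e).comp hF).lintegral_eq
  simp [h]

/-- The p-values are PRDS on the true nulls if the law of the scores does not change when a true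
null is exchanged with a calibration sample. -/
theorem prds_allPValues [IsProbabilityMeasure μ] (hS : Measurable S)
    {H0 : ∀ j, Finset (Fin (m j))}
    (hinv : ∀ j, ∀ t ∈ H0 j, ∀ e, IdentDistrib (fun ω => swapScores (S ω) j t e) S μ μ)
    (hties : ∀ j, ∀ᵐ ω ∂μ, Function.Injective fun i => S ω j (Sum.inr i)) :
    PRDS μ (fun ω => allPValues (S ω)) {i | i.2 ∈ H0 i.1} := by
  rintro Q hQ - ⟨j, t⟩ (ht : t ∈ H0 j)
  set v : Fin (ℓ j + 1) → ℝ := fun r => 1 / ((ℓ j : ℝ) + 1) * ((r : ℕ) + 1) with hv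
  have hpos : (0 : ℝ) < 1 / ((ℓ j : ℝ) + 1) := by positivity
  have hvmono : StrictMono v := fun r r' h => by
    simp only [hv]
    have : ((r : ℕ) : ℝ) < (r' : ℕ) := by exact_mod_cast h
    gcongr
  have hev : ∀ (P : Set ((Σ j, Fin (m j)) → ℝ)), MeasurableSet {ω | allPValues (S ω) ∈ P} :=
    fun P => hS (measurableSet_allPValues_mem P)
  have hY : Measurable fun ω => allPValues (S ω) ⟨j, t⟩ :=
    fun B _ => hev {p | p ⟨j, t⟩ ∈ B}
  -- Invariance replaces a probability by a sum over exchanges at fixed scores; without ties only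
  -- the competitor of rank `r + 1` contributes to it.
  have havg : ∀ (P : Set ((Σ j, Fin (m j)) → ℝ)) (r : Fin (ℓ j + 1)),
      ((ℓ j : ℝ≥0∞) + 1) * μ {ω | allPValues (S ω) ∈ P ∧ allPValues (S ω) ⟨j, t⟩ = v r} =
        ∫⁻ ω, ∑ e, {p | p ∈ P ∧ p ⟨j, t⟩ = v r}.indicator
          (1 : ((Σ j, Fin (m j)) → ℝ) → ℝ≥0∞) (allPValues (swapScores (S ω) j t e)) ∂μ := by
    intro P r
    have hm := measurableSet_allPValues_mem (k := k) (ℓ := ℓ) {p | p ∈ P ∧ p ⟨j, t⟩ = v r}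
    rw [← lintegral_eq_lintegral_sum_swapScores (j := j) (t := t) hS (hinv j t ht)
      (F := fun s => {p | p ∈ P ∧ p ⟨j, t⟩ = v r}.indicator 1 (allPValues s))]
    · exact congrArg (((ℓ j : ℝ≥0∞) + 1) * ·) (lintegral_indicator_one (hev {p | p ∈ P ∧ p ⟨j, t⟩ = v r})).symm
    · exact (measurable_const (a := (1 : ℝ≥0∞))).indicator hm
  have hL0 : ((ℓ j : ℝ≥0∞) + 1) ≠ 0 := by simp
  have hL : ((ℓ j : ℝ≥0∞) + 1) ≠ ∞ := by simp
  refine exists_monotone_condProb_version hY hvmono (fun ω => exists_allPValues_eq (S ω) j t)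
    (c := ((ℓ j : ℝ≥0∞) + 1)⁻¹) (ENNReal.inv_ne_zero.2 hL) (ENNReal.inv_ne_top.2 hL0) ?_
    (hev Q) ?_
  · intro r
    have h := havg Set.univ r
    rw [lintegral_congr_ae (g := fun _ => 1)] at h
    · simp only [Set.mem_univ, true_and, lintegral_const, measure_univ, mul_one] at h
      exact ENNReal.eq_inv_of_mul_eq_one_left (by rw [mul_comm]; exact h)
    · filter_upwards [hties j] with ω hω
      obtain ⟨e, -, he⟩ := sum_indicator_swapScores (t := t) hω Set.univ r
      simpa [hv] using he
  · intro r r' hr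
    refine (ENNReal.mul_le_mul_iff_right hL0 hL).1 ?_
    refine (havg Q r).trans_le (le_trans ?_ (havg Q r').symm.le)
    refine lintegral_mono_ae ?_
    filter_upwards [hties j] with ω hω
    obtain ⟨e, he, h⟩ := sum_indicator_swapScores (t := t) hω Q r
    obtain ⟨e', he', h'⟩ := sum_indicator_swapScores (t := t) hω Q r'
    simp only [hv]
    rw [h, h']
    -- The larger rank belongs to the lower score, so exchanging with `e'` raises all p-values and
    -- cannot leave the increasing set `Q`.
    have hle := allPValues_swapScores_mono (S ω) j t (e := e) (e' := e')
      (descRank_le_iff (v := fun x => S ω j (competitor (k j) t x)).1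
        (by rw [he, he']; exact Nat.succ_le_succ hr))
    by_cases hmem : allPValues (swapScores (S ω) j t e) ∈ Q
    · rw [Set.indicator_of_mem hmem, Set.indicator_of_mem (hQ hle hmem)]
      exact le_rfl
    · rw [Set.indicator_of_notMem hmem]
      exact zero_le

end SwapInvariance

/-! ### FDR control by averaging rejection shares -/

section FalseDiscoveries

variable {α : ℝ}

/-- The contribution of one hypothesis to the false discovery proportion of the BH procedure. -/
noncomputable def rejectionShare {ι : Type*} [Fintype ι] (α : ℝ) (i : ι) (p : ι → ℝ) : ℝ :=
  open Classical in
  (if i ∈ bhRejections α p then 1 else 0) / max ((bhRejections α p).card : ℝ) 1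

variable {K : ℕ} {k ℓ m : Fin K → ℕ}

theorem rejectionShare_nonneg {ι : Type*} [Fintype ι] (i : ι) (p : ι → ℝ) :
    0 ≤ rejectionShare α i p := by
  unfold rejectionShare
  positivity

theorem rejectionShare_le_one {ι : Type*} [Fintype ι] (i : ι) (p : ι → ℝ) :
    rejectionShare α i p ≤ 1 := by
  unfold rejectionShare
  refine div_le_one_of_le₀ (le_trans ?_ (le_max_right _ _)) (by positivity)
  split_ifs <;> simp

/-- The shares of a test position after the exchanges with its competitors add up to at most
`(ℓ + 1) α / N`. -/
theorem sum_rejectionShare_swapScores_le (hα : 0 ≤ α)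
    (s : ∀ j, BlockIdx (k j) (ℓ j) (m j) → ℝ) (j : Fin K) (t : Fin (m j)) :
    ∑ e, rejectionShare α ⟨j, t⟩ (allPValues (swapScores s j t e)) ≤
      ((ℓ j : ℝ) + 1) * (α / Fintype.card (Σ j, Fin (m j))) := by
  classical
  set P : Option (Fin (ℓ j)) → (Σ j, Fin (m j)) → ℝ := fun e => allPValues (swapScores s j t e)
    with hP
  set C := Finset.univ.filter fun e => (⟨j, t⟩ : Σ j, Fin (m j)) ∈ bhRejections α (P e) with hC
  rcases C.eq_empty_or_nonempty with hempty | hne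
  · have : ∀ e, rejectionShare α ⟨j, t⟩ (P e) = 0 := fun e => by
      have : e ∉ C := by simp [hempty]
      have h' : (⟨j, t⟩ : Σ j, Fin (m j)) ∉ bhRejections α (P e) := by simpa [hC] using this
      simp [rejectionShare, h']
    change ∑ e, rejectionShare α ⟨j, t⟩ (P e) ≤ _
    rw [Finset.sum_congr rfl fun e _ => this e, Finset.sum_const_zero]
    positivity
  -- The lowest score in `C` gives the largest p-values and hence the fewest rejections `R`, so
  -- every share is at most `1 / R`.
  obtain ⟨e₀, he₀, hmin⟩ := C.exists_min_image (fun e => s j (competitor (k j) t e)) hne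
  have hmem : (⟨j, t⟩ : Σ j, Fin (m j)) ∈ bhRejections α (P e₀) := by simpa [hC] using he₀
  set R : ℝ := ((bhRejections α (P e₀)).card : ℝ) with hR
  have hR1 : 1 ≤ R := by
    rw [hR]
    exact_mod_cast Finset.card_pos.2 ⟨_, hmem⟩
  have hterm : ∀ e, rejectionShare α ⟨j, t⟩ (P e) ≤ if e ∈ C then 1 / R else 0 := by
    intro e
    split_ifs with he
    · have h1 : (⟨j, t⟩ : Σ j, Fin (m j)) ∈ bhRejections α (P e) := by simpa [hC] using he
      have h2 : R ≤ max ((bhRejections α (P e)).card : ℝ) 1 := by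
        refine le_max_of_le_left ?_
        exact Nat.cast_le.2
          (card_bhRejections_anti hα (allPValues_swapScores_mono s j t (hmin e he)))
      simp only [rejectionShare, h1, if_true]
      gcongr
    · have h' : (⟨j, t⟩ : Σ j, Fin (m j)) ∉ bhRejections α (P e) := by simpa [hC] using he
      simp [rejectionShare, h']
  -- Every member of `C` scores at least as high as `e₀` and is counted in its rank; ties do no
  -- harm. The BH threshold at `e₀` bounds this rank by `(ℓ + 1) α R / N`, and `R` cancels.
  have hCcard : (C.card : ℝ) ≤ descRank (fun x => s j (competitor (k j) t x)) e₀ := by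
    unfold descRank
    exact_mod_cast Finset.card_le_card fun e he => by simpa using hmin e he
  have hrank := (mem_bhRejections hα _ _).1 hmem
  rw [← hR, show P e₀ ⟨j, t⟩ = _ from allPValues_swapScores_self s j t e₀] at hrank
  have hL : (0 : ℝ) < (ℓ j : ℝ) + 1 := by positivity
  calc ∑ e, rejectionShare α ⟨j, t⟩ (P e) ≤ ∑ e, if e ∈ C then 1 / R else 0 :=
        Finset.sum_le_sum fun e _ => hterm e
    _ = C.card / R := by rw [← Finset.sum_filter]; simp [div_eq_mul_inv]
    _ ≤ ((ℓ j : ℝ) + 1) * (α / Fintype.card (Σ j, Fin (m j))) := by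
        rw [div_le_iff₀ (by linarith)]
        rw [one_div, inv_mul_le_iff₀ hL] at hrank
        calc (C.card : ℝ) ≤ _ := hCcard
          _ ≤ _ := hrank
          _ = _ := by ring

variable {Ω : Type*} [MeasurableSpace Ω] {μ : Measure Ω} [IsProbabilityMeasure μ]
  {S : Ω → ∀ j, BlockIdx (k j) (ℓ j) (m j) → ℝ}

/-- All `ℓ + 1` exchanges have the same expected share, so the pointwise bound on their sum is
divided by `ℓ + 1`. -/
theorem integral_rejectionShare_le (hα : 0 ≤ α) (hS : Measurable S) {j : Fin K} {t : Fin (m j)}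
    (hinv : ∀ e, IdentDistrib (fun ω => swapScores (S ω) j t e) S μ μ) :
    Integrable (fun ω => rejectionShare α ⟨j, t⟩ (allPValues (S ω))) μ ∧
      ∫ ω, rejectionShare α ⟨j, t⟩ (allPValues (S ω)) ∂μ ≤
        α / Fintype.card (Σ j, Fin (m j)) := by
  set F : (∀ j, BlockIdx (k j) (ℓ j) (m j) → ℝ) → ℝ :=
    fun s => rejectionShare α ⟨j, t⟩ (allPValues s) with hF
  have hFm : Measurable F := fun B _ =>
    measurableSet_allPValues_mem {p | rejectionShare α (⟨j, t⟩ : Σ j, Fin (m j)) p ∈ B}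
  have hint : Integrable (fun ω => F (S ω)) μ :=
    Integrable.of_bound (hFm.comp hS).aestronglyMeasurable 1 (ae_of_all _ fun ω => by
      rw [Real.norm_of_nonneg (rejectionShare_nonneg _ _)]
      exact rejectionShare_le_one _ _)
  refine ⟨hint, ?_⟩
  have hid : ∀ e, IdentDistrib (fun ω => F (swapScores (S ω) j t e)) (fun ω => F (S ω)) μ μ :=
    fun e => (hinv e).comp hFm
  have hsum : ((ℓ j : ℝ) + 1) * ∫ ω, F (S ω) ∂μ = ∫ ω, ∑ e, F (swapScores (S ω) j t e) ∂μ := by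
    rw [integral_finsetSum _ fun e _ => (hid e).integrable_iff.2 hint]
    simp [fun e => (hid e).integral_eq]
  have hle : ∫ ω, ∑ e, F (swapScores (S ω) j t e) ∂μ ≤
      ∫ _, ((ℓ j : ℝ) + 1) * (α / Fintype.card (Σ j, Fin (m j))) ∂μ :=
    integral_mono (integrable_finsetSum _ fun e _ => (hid e).integrable_iff.2 hint)
      (integrable_const _) fun ω => sum_rejectionShare_swapScores_le hα (S ω) j t
  rw [integral_const, probReal_univ, one_smul, ← hsum] at hle
  exact le_of_mul_le_mul_left hle (by positivity)

/-- FastLSU controls the global FDR if the law of the scores does not change when a true null is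
exchanged with a calibration sample. -/
theorem globalFDR_fastLSURejections_le (hα : 0 ≤ α) (hS : Measurable S)
    {H0 : ∀ j, Finset (Fin (m j))}
    (hinv : ∀ j, ∀ t ∈ H0 j, ∀ e, IdentDistrib (fun ω => swapScores (S ω) j t e) S μ μ) :
    globalFDR μ H0 (fun ω => fastLSURejections α fun j t => conformalPValue (S ω j) t) ≤ α := by
  classical
  have hcard : ∀ p : ∀ j, Fin (m j) → ℝ,
      ∑ j, (fastLSURejections α p j).card = (bhRejections α (concat p)).card := by
    intro p
    have h : bhRejections α (concat p) =
        Finset.univ.filter fun i : Σ j, Fin (m j) => i.2 ∈ fastLSURejections α p i.1 := by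
      ext i
      simp [mem_fastLSURejections_iff hα]
    rw [h, Finset.card_filter, Fintype.sum_sigma]
    refine Finset.sum_congr rfl fun j _ => ?_
    simp only [← Finset.card_filter]
    exact congrArg Finset.card (Finset.filter_univ_mem _).symm
  have hfdp : ∀ ω, ((∑ j, (fastLSURejections α (fun j t => conformalPValue (S ω j) t) j ∩
        H0 j).card : ℕ) : ℝ) /
      max ((∑ j, (fastLSURejections α (fun j t => conformalPValue (S ω j) t) j).card : ℕ) : ℝ) 1 =
      ∑ j, ∑ t ∈ H0 j, rejectionShare α ⟨j, t⟩ (allPValues (S ω)) := by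
    intro ω
    have hmem : ∀ j t, t ∈ fastLSURejections α (fun j t => conformalPValue (S ω j) t) j ↔
        (⟨j, t⟩ : Σ j, Fin (m j)) ∈ bhRejections α (allPValues (S ω)) :=
      mem_fastLSURejections_iff hα _
    simp only [rejectionShare, ← Finset.sum_div]
    rw [hcard, Nat.cast_sum]
    refine congrArg (· / _) (Finset.sum_congr rfl fun j _ => ?_)
    rw [Finset.inter_comm, ← Finset.filter_mem_eq_inter, Finset.card_filter, Nat.cast_sum]
    refine Finset.sum_congr rfl fun t _ => ?_
    by_cases ht : (⟨j, t⟩ : Σ j, Fin (m j)) ∈ bhRejections α (allPValues (S ω)) <;> simp [hmem, ht]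
  unfold globalFDR
  simp only [hfdp]
  rw [integral_finsetSum _ fun j _ => integrable_finsetSum _ fun t ht =>
    (integral_rejectionShare_le hα hS (hinv j t ht)).1]
  calc ∑ j, ∫ ω, ∑ t ∈ H0 j, rejectionShare α ⟨j, t⟩ (allPValues (S ω)) ∂μ
      = ∑ j, ∑ t ∈ H0 j, ∫ ω, rejectionShare α ⟨j, t⟩ (allPValues (S ω)) ∂μ :=
        Finset.sum_congr rfl fun j _ => integral_finsetSum _ fun t ht =>
          (integral_rejectionShare_le hα hS (hinv j t ht)).1
    _ ≤ ∑ j, ∑ t ∈ H0 j, α / Fintype.card (Σ j, Fin (m j)) :=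
        Finset.sum_le_sum fun j _ => Finset.sum_le_sum fun t ht =>
          (integral_rejectionShare_le hα hS (hinv j t ht)).2
    _ ≤ ∑ j, ∑ t : Fin (m j), α / Fintype.card (Σ j, Fin (m j)) :=
        Finset.sum_le_sum fun j _ => Finset.sum_le_sum_of_subset_of_nonneg
          (Finset.subset_univ _) fun _ _ _ => by positivity
    _ = (Fintype.card (Σ j, Fin (m j)) : ℝ) * (α / Fintype.card (Σ j, Fin (m j))) := by
        simp only [Finset.sum_const, Finset.card_univ, nsmul_eq_mul, ← Finset.sum_mul,
          Fintype.card_sigma, Nat.cast_sum]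
    _ ≤ α := by
        -- Without hypotheses the quotient by zero is 0, and the bound reduces to `0 ≤ α`.
        rcases Nat.eq_zero_or_pos (Fintype.card (Σ j, Fin (m j))) with h | h
        · simp [h, hα]
        · have : (0 : ℝ) < Fintype.card (Σ j, Fin (m j)) := by exact_mod_cast h
          exact (mul_div_cancel₀ α this.ne').le

end FalseDiscoveries

/-! ### Conditional exchangeability as invariance of a joint law -/

section ConditionalExchangeability

variable {Ω : Type*} {mΩ : MeasurableSpace Ω} {μ : Measure Ω} [IsProbabilityMeasure μ]

/-- Two events have the same conditional probability given `m'` if and only if their intersections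
with every event of `m'` have the same probability. -/
theorem condProb_ae_eq_iff {m' : MeasurableSpace Ω} (hm : m' ≤ mΩ) {E₁ E₂ : Set Ω}
    (h₁ : MeasurableSet[mΩ] E₁) (h₂ : MeasurableSet[mΩ] E₂) :
    μ⟦E₁ | m'⟧ =ᵐ[μ] μ⟦E₂ | m'⟧ ↔
      ∀ s, MeasurableSet[m'] s → μ (E₁ ∩ s) = μ (E₂ ∩ s) := by
  have hint : ∀ {E : Set Ω}, MeasurableSet[mΩ] E → Integrable (E.indicator fun _ => (1 : ℝ)) μ :=
    fun hE => (integrable_const _).indicator hE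
  have hset : ∀ {E : Set Ω}, MeasurableSet[mΩ] E → ∀ s, MeasurableSet[m'] s →
      ∫ ω in s, (μ⟦E | m'⟧) ω ∂μ = μ.real (E ∩ s) := by
    intro E hE s hs
    rw [setIntegral_condExp hm (hint hE) hs]
    have := integral_indicator_one (μ := μ.restrict s) hE
    rw [measureReal_restrict_apply hE] at this
    exact this
  constructor
  · intro h s hs
    have : μ.real (E₁ ∩ s) = μ.real (E₂ ∩ s) := by
      rw [← hset h₁ s hs, ← hset h₂ s hs]
      exact integral_congr_ae (ae_restrict_of_ae h)
    exact (measureReal_eq_measureReal_iff).1 this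
  · intro h
    refine ae_eq_condExp_of_forall_setIntegral_eq hm (hint h₂)
      (fun s _ _ => integrable_condExp.integrableOn) (fun s hs _ => ?_)
      stronglyMeasurable_condExp.aestronglyMeasurable
    rw [hset h₁ s hs, ← setIntegral_condExp hm (hint h₂) hs, hset h₂ s hs, measureReal_def,
      measureReal_def, h s hs]

variable {ι S T : Type*} [MeasurableSpace S] [MeasurableSpace T]

/-- Conditional exchangeability means that the joint law with the conditioning variable is
invariant. -/
theorem condExchangeable_iff_identDistrib {X : Ω → ι → S} {W : Ω → T} (hX : Measurable X)
    (hW : Measurable W) {G : Set (Equiv.Perm ι)} :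
    CondExchangeable μ X W G ↔
      ∀ π ∈ G, IdentDistrib (fun ω => (fun i => X ω (π i), W ω)) (fun ω => (X ω, W ω)) μ μ := by
  have hXπ : ∀ π : Equiv.Perm ι, Measurable fun ω i => X ω (π i) := fun π =>
    measurable_pi_iff.2 fun i => (measurable_pi_apply _).comp hX
  refine forall₂_congr fun π _ => ?_
  constructor
  · intro h
    refine ⟨((hXπ π).prodMk hW).aemeasurable, (hX.prodMk hW).aemeasurable, ?_⟩
    have := Measure.isProbabilityMeasure_map (μ := μ) ((hXπ π).prodMk hW).aemeasurable
    -- Rectangles determine the joint law, and `W ∈ C` runs through all conditioning events.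
    refine Measure.ext_prod fun {B C} hB hC => ?_
    rw [Measure.map_apply ((hXπ π).prodMk hW) (hB.prod hC),
      Measure.map_apply (hX.prodMk hW) (hB.prod hC)]
    exact (condProb_ae_eq_iff hW.comap_le (hXπ π hB) (hX hB)).1 (h B hB) _ ⟨C, hC, rfl⟩
  · intro h B hB
    refine (condProb_ae_eq_iff hW.comap_le (hXπ π hB) (hX hB)).2 ?_
    rintro _ ⟨C, hC, rfl⟩
    exact h.measure_mem_eq (hB.prod hC)

end ConditionalExchangeability

/-! ### Invariance of joint laws under independence -/

section Independence

variable {Ω : Type*} [MeasurableSpace Ω] {μ : Measure Ω} [IsProbabilityMeasure μ]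

/-- Transformations that preserve the laws of the members of an independent family preserve its
joint law. -/
theorem iIndepFun.identDistrib_map {ι : Type*} [Fintype ι] {X : ι → Type*}
    [∀ i, MeasurableSpace (X i)] {D : ∀ i, Ω → X i} (hD : ∀ i, Measurable (D i))
    (h : iIndepFun D μ) {φ : ∀ i, X i → X i} (hφ : ∀ i, Measurable (φ i))
    (hlaw : ∀ i, IdentDistrib (fun ω => φ i (D i ω)) (D i) μ μ) :
    IdentDistrib (fun ω i => φ i (D i ω)) (fun ω i => D i ω) μ μ := by
  refine ⟨(measurable_pi_iff.2 fun i => (hφ i).comp (hD i)).aemeasurable,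
    (measurable_pi_iff.2 hD).aemeasurable, ?_⟩
  have hcomp : iIndepFun (fun i ω => φ i (D i ω)) μ := h.comp φ hφ
  have hm : ∀ i, AEMeasurable (fun ω => φ i (D i ω)) μ :=
    fun i => ((hφ i).comp (hD i)).aemeasurable
  rw [(iIndepFun_iff_map_fun_eq_pi_map hm).1 hcomp, (iIndepFun_iff_map_fun_eq_pi_map fun i => (hD i).aemeasurable).1 h]
  exact congrArg _ (funext fun i => (hlaw i).map_eq)

end Independence

/-! ### Permuting one evaluation block -/

section BlockPermutations

variable {K : ℕ} {k ℓ m : Fin K → Fin K → ℕ}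

/-- The family of permutations that permutes the evaluation block of agent `j` by `σ` and leaves
all other blocks unchanged. -/
def singleBlockPerm (k ℓ m : Fin K → Fin K → ℕ) (j : Fin K)
    (σ : Equiv.Perm (BlockIdx (k j j) (ℓ j j) (m j j))) :
    ∀ a b : Fin K, Equiv.Perm (BlockIdx (k a b) (ℓ a b) (m a b)) :=
  Function.update (fun _ _ => Equiv.refl _) j (Function.update (fun _ => Equiv.refl _) j σ)

theorem singleBlockPerm_self (j : Fin K) (σ : Equiv.Perm (BlockIdx (k j j) (ℓ j j) (m j j))) :
    singleBlockPerm k ℓ m j σ j j = σ := by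
  simp [singleBlockPerm]

theorem singleBlockPerm_of_ne {j a b : Fin K} (h : a ≠ j ∨ b ≠ j)
    (σ : Equiv.Perm (BlockIdx (k j j) (ℓ j j) (m j j))) :
    singleBlockPerm k ℓ m j σ a b = Equiv.refl _ := by
  by_cases ha : a = j
  · subst ha
    simp [singleBlockPerm, Function.update_of_ne (h.resolve_left (not_not.2 rfl))]
  · simp [singleBlockPerm, Function.update_of_ne ha]

/-- Permuting the evaluation block of one agent after the training positions permutes the scores of
this agent and does not change the scores of the others. -/
theorem blockScores_singleBlockPerm {Z Θ Θq : Type*}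
    {g : ∀ j : Fin K, Z → (BlockIdx (k j j) (ℓ j j) (m j j) → Z) → ℝ} {f : Z → Θq → ℝ}
    {q : Θ → Θq} {A : ∀ a j : Fin K, (BlockIdx (k a j) (ℓ a j) (m a j) → Z) → Θ}
    (h_inv : ∀ (j : Fin K) (σ : Equiv.Perm (Fin (ℓ j j) ⊕ Fin (m j j))) (z : Z)
      (h : BlockIdx (k j j) (ℓ j j) (m j j) → Z), g j z (h ∘ Sum.map id σ) = g j z h)
    (j : Fin K) {ρ : Equiv.Perm (BlockIdx (k j j) (ℓ j j) (m j j))}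
    (hρ : ∃ σ : Equiv.Perm (Fin (ℓ j j) ⊕ Fin (m j j)), ⇑ρ = Sum.map id σ)
    (x : ∀ a b : Fin K, BlockIdx (k a b) (ℓ a b) (m a b) → Z) :
    (fun j' => blockScores g f q A (fun a b => x a b ∘ singleBlockPerm k ℓ m j ρ a b) j') =
      Function.update (fun j' => blockScores g f q A x j') j (blockScores g f q A x j ∘ ρ) := by
  funext j'
  by_cases hj : j' = j
  · subst hj
    obtain ⟨σ, hσ⟩ := hρ
    rw [Function.update_self]
    funext i
    simp only [blockScores, compositeScore, Function.comp_apply, singleBlockPerm_self]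
    refine Finset.sup'_congr _ rfl fun a _ => ?_
    split_ifs with ha
    · rw [hσ, h_inv]
    · rw [singleBlockPerm_of_ne (Or.inl ha)]
      rfl
  · rw [Function.update_of_ne hj]
    -- The scores of `j'` use only blocks designated for `j'`, and the permuted block is designated
    -- for `j`.
    have h : ∀ a, x a j' ∘ singleBlockPerm k ℓ m j ρ a j' = x a j' := fun a => by
      rw [singleBlockPerm_of_ne (Or.inr hj)]
      rfl
    funext i
    simp only [blockScores, compositeScore, h]

end BlockPermutations

/-! ### Invariance of the law of all composite scores -/

section Blocks

variable {Ω Z Θ Θq : Type*} [MeasurableSpace Ω] [MeasurableSpace Z] [MeasurableSpace Θ]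
  [MeasurableSpace Θq] {μ : Measure Ω} [IsProbabilityMeasure μ] {K : ℕ}

/-- A block is determined by its null part and its novelty part, so that conditional
exchangeability of the nulls makes the law of the block invariant. -/
theorem identDistrib_comp_extendNullPerm {k ℓ m : ℕ} {H0 : Finset (Fin m)}
    {X : Ω → BlockIdx k ℓ m → Z} (hX : Measurable X)
    (h : CondExchangeable μ (fun ω => nullPart H0 (X ω)) (fun ω => noveltyPart H0 (X ω)) Set.univ)
    (π : Equiv.Perm (Fin k ⊕ (Fin ℓ ⊕ {t : Fin m // t ∈ H0}))) :
    IdentDistrib (fun ω => X ω ∘ extendNullPerm H0 π) X μ μ := by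
  have hn : Measurable fun ω => nullPart H0 (X ω) := by
    simp only [nullPart_eq]
    fun_prop
  have hv : Measurable fun ω => noveltyPart H0 (X ω) := by
    simp only [noveltyPart_eq]
    fun_prop
  let merge : ((Fin k ⊕ (Fin ℓ ⊕ {t : Fin m // t ∈ H0})) → Z) × ({t : Fin m // t ∉ H0} → Z) →
      BlockIdx k ℓ m → Z := fun y i => Sum.elim y.1 y.2 ((nullNoveltyEquiv k ℓ H0).symm i)
  have hmerge : Measurable merge := by
    refine measurable_pi_iff.2 fun i => ?_
    rcases hi : (nullNoveltyEquiv k ℓ H0).symm i with a | a <;> simp only [merge, hi] <;>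
      simp only [Sum.elim_inl, Sum.elim_inr] <;> fun_prop
  have hrec : ∀ y : BlockIdx k ℓ m → Z, merge (nullPart H0 y, noveltyPart H0 y) = y := by
    intro y
    funext i
    obtain ⟨a, rfl⟩ := (nullNoveltyEquiv k ℓ H0).surjective i
    rcases a with a | a <;> simp [merge, nullPart_eq, noveltyPart_eq]
  have := ((condExchangeable_iff_identDistrib hn hv).1 h π trivial).comp hmerge
  convert this using 1
  · funext ω
    simp only [Function.comp_apply]
    rw [← nullPart_comp_extendNullPerm, ← noveltyPart_comp_extendNullPerm H0 (X ω) π, hrec]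
  · funext ω
    simp only [Function.comp_apply, hrec]

variable {k ℓ m : Fin K → Fin K → ℕ}
  {g : ∀ j : Fin K, Z → (BlockIdx (k j j) (ℓ j j) (m j j) → Z) → ℝ} {f : Z → Θq → ℝ} {q : Θ → Θq}
  {A : ∀ a j : Fin K, (BlockIdx (k a j) (ℓ a j) (m a j) → Z) → Θ}

theorem measurable_blockScores (hg : ∀ j, Measurable (Function.uncurry (g j)))
    (hA : ∀ a j, Measurable (A a j)) (hq : Measurable q) (hf : Measurable (Function.uncurry f)) :
    Measurable fun (x : ∀ a j : Fin K, BlockIdx (k a j) (ℓ a j) (m a j) → Z) (j : Fin K) =>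
      blockScores g f q A x j := by
  refine measurable_pi_iff.2 fun j => measurable_pi_iff.2 fun i => ?_
  have hblock : ∀ a b : Fin K, Measurable
      fun x : ∀ a j : Fin K, BlockIdx (k a j) (ℓ a j) (m a j) → Z => x a b := fun a b => by fun_prop
  have hz : Measurable
      fun x : ∀ a j : Fin K, BlockIdx (k a j) (ℓ a j) (m a j) → Z => x j j i :=
    (measurable_pi_apply i).comp (hblock j j)
  let F : Fin K → (∀ a j : Fin K, BlockIdx (k a j) (ℓ a j) (m a j) → Z) → ℝ := fun a x =>
    if a = j then g j (x j j i) (x j j) else f (x j j i) (q (A a j (x a j)))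
  have h : ∀ a ∈ Finset.univ, Measurable (F a) := by
    intro a _
    simp only [F]
    split_ifs
    · exact (hg j).comp (hz.prodMk (hblock j j))
    · exact hf.comp (hz.prodMk (hq.comp ((hA a j).comp (hblock a j))))
  convert Finset.measurable_sup' ⟨j, Finset.mem_univ j⟩ h using 1
  funext x
  exact (Finset.sup'_apply (C := fun _ => ℝ) ⟨j, Finset.mem_univ j⟩ F x).symm

/-- The joint law of all scores does not change when the null scores of one agent are permuted
by a permutation that fixes the training positions. -/
theorem identDistrib_update_blockScores
    {D : ∀ a j : Fin K, Ω → BlockIdx (k a j) (ℓ a j) (m a j) → Z} (hD : ∀ a j, Measurable (D a j))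
    {H0 : ∀ j : Fin K, Finset (Fin (m j j))} (hg : ∀ j, Measurable (Function.uncurry (g j)))
    (hA : ∀ a j, Measurable (A a j)) (hq : Measurable q) (hf : Measurable (Function.uncurry f))
    (h_agents : iIndepFun (fun (a : Fin K) (ω : Ω) (j : Fin K) => D a j ω) μ)
    (h_blocks : ∀ a : Fin K, iIndepFun (fun (j : Fin K) (ω : Ω) => D a j ω) μ)
    (h_exch : ∀ j : Fin K, CondExchangeable μ (fun ω => nullPart (H0 j) (D j j ω))
      (fun ω => noveltyPart (H0 j) (D j j ω)) Set.univ)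
    (h_inv : ∀ (j : Fin K) (σ : Equiv.Perm (Fin (ℓ j j) ⊕ Fin (m j j))) (z : Z)
      (h : BlockIdx (k j j) (ℓ j j) (m j j) → Z), g j z (h ∘ Sum.map id σ) = g j z h)
    (j : Fin K) {π : Equiv.Perm (Fin (k j j) ⊕ (Fin (ℓ j j) ⊕ {t : Fin (m j j) // t ∈ H0 j}))}
    (hπ : π ∈ fixTraining (k j j) (ℓ j j) (H0 j)) :
    IdentDistrib
      (fun ω => Function.update (fun j' => blockScores g f q A (fun a b => D a b ω) j') j
        (blockScores g f q A (fun a b => D a b ω) j ∘ extendNullPerm (H0 j) π))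
      (fun ω j' => blockScores g f q A (fun a b => D a b ω) j') μ μ := by
  set ρ := singleBlockPerm k ℓ m j (extendNullPerm (H0 j) π) with hρ
  have hφ : ∀ a b, Measurable fun y : BlockIdx (k a b) (ℓ a b) (m a b) → Z => y ∘ ρ a b :=
    fun a b => measurable_pi_iff.2 fun i => measurable_pi_apply _
  have hlaw : ∀ a b, IdentDistrib (fun ω => D a b ω ∘ ρ a b) (D a b) μ μ := by
    intro a b
    by_cases hab : a ≠ j ∨ b ≠ j
    · rw [hρ, singleBlockPerm_of_ne hab]
      exact IdentDistrib.refl (hD a b).aemeasurable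
    · push Not at hab
      obtain ⟨rfl, rfl⟩ := hab
      rw [hρ, singleBlockPerm_self]
      exact identDistrib_comp_extendNullPerm (hD _ _) (h_exch _) π
  -- Invariance is lifted twice: from single blocks to the data of one agent, then from the agents
  -- to all data.
  have hdata : IdentDistrib (fun ω a b => D a b ω ∘ ρ a b) (fun ω a b => D a b ω) μ μ :=
    iIndepFun.identDistrib_map (φ := fun a y b => y b ∘ ρ a b)
      (fun a => measurable_pi_iff.2 fun b => hD a b) h_agents
      (fun a => measurable_pi_iff.2 fun b => (hφ a b).comp (measurable_pi_apply b))
      fun a => iIndepFun.identDistrib_map (φ := fun b y => y ∘ ρ a b) (hD a) (h_blocks a) (hφ a)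
        (hlaw a)
  have h := hdata.comp (measurable_blockScores hg hA hq hf)
  have hupdate := fun ω => blockScores_singleBlockPerm (f := f) (q := q) (A := A) h_inv j
    (exists_extendNullPerm_eq_sumMap (H0 j) hπ) (fun a b => D a b ω)
  simp only [← hupdate]
  exact h

end Blocks

/-! ### The main theorem -/

theorem mainTheorem1
    {Ω Z Θ Θq : Type*} [MeasurableSpace Ω] [MeasurableSpace Z] [MeasurableSpace Θ]
    [MeasurableSpace Θq] (μ : Measure Ω) [IsProbabilityMeasure μ]
    (K : ℕ) (hK : 2 ≤ K)
    -- sizes of the block of agent `a` that is designated for agent `j`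
    (k ℓ m : Fin K → Fin K → ℕ)
    -- the data blocks; `D j j` is the evaluation block of agent `j`
    (D : ∀ a j : Fin K, Ω → BlockIdx (k a j) (ℓ a j) (m a j) → Z)
    (hD : ∀ a j, Measurable (D a j))
    -- true nulls among the test points of the evaluation blocks
    (H0 : ∀ j : Fin K, Finset (Fin (m j j)))
    -- the agents' own score functions, the learning algorithm, the quantizer, the surrogate scores
    (g : ∀ j : Fin K, Z → (BlockIdx (k j j) (ℓ j j) (m j j) → Z) → ℝ)
    (hg : ∀ j, Measurable (Function.uncurry (g j)))
    (A : ∀ a j : Fin K, (BlockIdx (k a j) (ℓ a j) (m a j) → Z) → Θ)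
    (hA : ∀ a j, Measurable (A a j))
    (q : Θ → Θq) (hq : Measurable q)
    (f : Z → Θq → ℝ) (hf : Measurable (Function.uncurry f))
    -- the agents' data sets are mutually independent
    (h_agents : iIndepFun (fun (a : Fin K) (ω : Ω) (j : Fin K) => D a j ω) μ)
    -- the blocks of each agent are mutually independent
    (h_blocks : ∀ a : Fin K, iIndepFun (fun (j : Fin K) (ω : Ω) => D a j ω) μ)
    -- nulls are exchangeable conditionally on the novelties
    (h_exch : ∀ j : Fin K, CondExchangeable μ (fun ω => nullPart (H0 j) (D j j ω))
      (fun ω => noveltyPart (H0 j) (D j j ω)) Set.univ)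
    -- `g j` ignores the order of the calibration and test samples
    (h_inv : ∀ (j : Fin K) (σ : Equiv.Perm (Fin (ℓ j j) ⊕ Fin (m j j))) (z : Z)
      (h : BlockIdx (k j j) (ℓ j j) (m j j) → Z), g j z (h ∘ Sum.map id σ) = g j z h)
    -- almost surely no ties among the composite scores of calibration and test samples
    (h_ties : ∀ j : Fin K, ∀ᵐ ω ∂μ, Function.Injective
      fun i : Fin (ℓ j j) ⊕ Fin (m j j) =>
        blockScores g f q A (fun a b => D a b ω) j (Sum.inr i))
    (α : ℝ) (hα0 : 0 ≤ α) (hα1 : α ≤ 1) :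
    let S : Ω → ∀ j : Fin K, BlockIdx (k j j) (ℓ j j) (m j j) → ℝ :=
      fun ω j => blockScores g f q A (fun a b => D a b ω) j
    let p : Ω → ∀ j : Fin K, Fin (m j j) → ℝ := fun ω j t => conformalPValue (S ω j) t
    -- conditional exchangeability of the quantized composite scores
    (∀ j : Fin K, CondExchangeable μ (fun ω => nullPart (H0 j) (S ω j))
      (fun ω => noveltyPart (H0 j) (S ω j)) (fixTraining (k j j) (ℓ j j) (H0 j))) ∧
    -- the local p-values are PRDS
    (∀ j : Fin K, PRDS μ (fun ω => p ω j) {t | t ∈ H0 j}) ∧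
    -- the concatenated p-values are PRDS
    PRDS μ (fun ω => concat (p ω)) {i | i.2 ∈ H0 i.1} ∧
    -- FastLSU rejects what the global BH procedure rejects
    (∀ ω j t, t ∈ fastLSURejections α (p ω) j ↔ ⟨j, t⟩ ∈ bhRejections α (concat (p ω))) ∧
    -- global FDR control
    globalFDR μ H0 (fun ω j => fastLSURejections α (p ω) j) ≤ α := by
  intro S p
  have hS : Measurable S :=
    (measurable_blockScores hg hA hq hf).comp
      (measurable_pi_iff.2 fun a => measurable_pi_iff.2 fun b => hD a b)
  have hlaw : ∀ j, ∀ π ∈ fixTraining (k j j) (ℓ j j) (H0 j), IdentDistrib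
      (fun ω => Function.update (S ω) j (S ω j ∘ extendNullPerm (H0 j) π)) S μ μ :=
    fun j π hπ =>
      identDistrib_update_blockScores hD hg hA hq hf h_agents h_blocks h_exch h_inv j hπ
  have hinv : ∀ j, ∀ t ∈ H0 j, ∀ e, IdentDistrib (fun ω => swapScores (S ω) j t e) S μ μ := by
    intro j t ht e
    obtain ⟨π, hπ, h⟩ := exists_competitorSwap_eq_extendNullPerm (k := k j j) (H0 j) ht e
    simpa only [swapScores, ← h] using hlaw j π hπ
  have hprds : PRDS μ (fun ω => concat (p ω)) {i | i.2 ∈ H0 i.1} :=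
    prds_allPValues hS hinv h_ties
  refine ⟨fun j => ?_, fun j => hprds.comp fun t => ⟨j, t⟩, hprds,
    fun ω => mem_fastLSURejections_iff hα0 (p ω), globalFDR_fastLSURejections_le hα0 hS hinv⟩
  have hn : Measurable fun s : BlockIdx (k j j) (ℓ j j) (m j j) → ℝ => nullPart (H0 j) s := by
    simp only [nullPart_eq]
    fun_prop
  have hv : Measurable fun s : BlockIdx (k j j) (ℓ j j) (m j j) → ℝ => noveltyPart (H0 j) s := by
    simp only [noveltyPart_eq]
    fun_prop
  have hSj : Measurable fun ω => S ω j := (measurable_pi_apply j).comp hS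
  -- Conclusion (a) is the invariance of the law of all scores, read off on the null and novelty
  -- parts of coordinate `j`.
  refine (condExchangeable_iff_identDistrib (hn.comp hSj) (hv.comp hSj)).2 fun π hπ => ?_
  have := (hlaw j π hπ).comp ((hn.prodMk hv).comp (measurable_pi_apply j))
  convert this using 1
  · funext ω
    simp only [Function.comp_apply, Function.update_self, nullPart_comp_extendNullPerm,
      noveltyPart_comp_extendNullPerm]
  · rfl
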